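/- Let $d\ge 0$ be an integer and let $\mathcal M\subset\mathbb R^d$ be a nonempty compact set with positive reach, i.e. there is $r>0$ such that every $x\in\mathbb R^d$ with $d_{\mathcal M}(x)<r$ has a unique closest point in $\mathcal M$, where $d_{\mathcal M}(x)=\inf_{y\in\mathcal M}|x-y|$. Let $W:\mathbb R^d\to\mathbb R$ be of class $C^2$, symmetric ($W(-x)=W(x)$), semiconvex ($x\mapsto W(x)-\tfrac{\lambda}{2}|x|^2$ is convex for some $\lambda\in\mathbb R$), bounded from below, and of at most quadratic growth at infinity ($W(x)=O(|x|^2)$ as $|x|\to\infty$). Let $\mathcal P_2(\mathbb R^d)$ be the set of Borel probability measures on $\mathbb R^d$ with finite second moment, endowed with the quadratic Wasserstein distance $d_2$, and let $\mathcal P(\mathcal M)\subset\mathcal P_2(\mathbb R^d)$ be the set of those supported in $\mathcal M$. With $W*\rho(x)=\int_{\mathbb R^d}W(x-y)\,\mathrm d\rho(y)$, define for $\rho\in\mathcal P_2(\mathbb R^d)$ and $\varepsilon>0$ $$E(\rho)=\begin{cases}\frac12\int_{\mathcal M}W*\rho\,\mathrm d\rho&\text{if }\rho\in\mathcal P(\mathcal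 M),\\ \infty&\text{otherwise,}\end{cases}\qquad E_\varepsilon(\rho)=\frac12\int_{\mathbb R^d}W*\rho\,\mathrm d\rho+\frac1\varepsilon\int_{\mathbb R^d}d_{\mathcal M}^2\,\mathrm d\rho .$$ Then: 1. For every $\varepsilon>0$ the functional $E_\varepsilon$ has a minimizer on $\mathcal P_2(\mathbb R^d)$. 2. For every choice of minimizers $\rho_\varepsilon^*$ of $E_\varepsilon$, $\varepsilon>0$, and every sequence $\varepsilon_n>0$ with $\varepsilon_n\to0$, there are a subsequence $(\varepsilon_{n_k})_k$ and a measure $\rho^*\in\mathcal P(\mathcal M)$ such that $d_2(\rho_{\varepsilon_{n_k}}^*,\rho^*)\to0$ as $k\to\infty$ and $\rho^*$ minimizes $E$ on $\mathcal P_2(\mathbb R^d)$. -/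

import Mathlib

open MeasureTheory Filter Topology
open scoped ENNReal

noncomputable section

namespace AttractingManifold

/-- `ℝ^d` with the Euclidean norm. -/
abbrev Space (d : ℕ) : Type := EuclideanSpace ℝ (Fin d)

/-- `P₂(ℝ^d)`: the Borel probability measures on `ℝ^d` with finite second moment. -/
abbrev P2 (d : ℕ) : Type :=
  {ρ : ProbabilityMeasure (Space d) // ∫⁻ x, ‖x‖ₑ ^ 2 ∂(ρ : Measure (Space d)) < ∞}

/-- The Borel measure underlying an element of `P₂(ℝ^d)`. -/
abbrev P2.meas {d : ℕ} (ρ : P2 d) : Measure (Space d) := (ρ.1 : Measure (Space d))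

/-- `P(M)`: the measures supported in `M`. For closed `M`, having support contained in `M` is the
same as giving no mass to the complement of `M`; for compact `M` every such probability measure
has finite second moment. -/
def supportedIn {d : ℕ} (M : Set (Space d)) : Set (P2 d) := {ρ | ρ.meas Mᶜ = 0}

/-- The transport plans from `ρ₀` to `ρ₁`. -/
def transportPlans {d : ℕ} (ρ₀ ρ₁ : P2 d) : Set (ProbabilityMeasure (Space d × Space d)) :=
  {π | (π : Measure (Space d × Space d)).map Prod.fst = ρ₀.meas ∧
       (π : Measure (Space d × Space d)).map Prod.snd = ρ₁.meas}

/-- The quadratic Wasserstein distance `d₂`, with values in `[0,∞]` (it is finite on `P₂`). -/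
def wasserstein {d : ℕ} (ρ₀ ρ₁ : P2 d) : ℝ≥0∞ :=
  ⨅ π ∈ transportPlans ρ₀ ρ₁,
    (∫⁻ z, edist z.1 z.2 ^ 2 ∂(π : Measure (Space d × Space d))) ^ (1 / 2 : ℝ)

/-- The reach of `M`: the supremum of the radii `r` such that every point at distance less than
`r` from `M` has a unique closest point in `M`. -/
def reach {d : ℕ} (M : Set (Space d)) : ℝ≥0∞ :=
  sSup {r : ℝ≥0∞ | ∀ x, Metric.infEDist x M < r →
    ∃! y, y ∈ M ∧ edist x y = Metric.infEDist x M}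

/-- The assumptions on the interaction potential: `C²`, symmetric, semiconvex, bounded from below,
with at most quadratic growth at infinity. -/
structure IsAdmissiblePotential {d : ℕ} (W : Space d → ℝ) : Prop where
  contDiff : ContDiff ℝ 2 W
  symm : ∀ x, W (-x) = W x
  semiconvex : ∃ l : ℝ, ConvexOn ℝ Set.univ (fun x => W x - l / 2 * ‖x‖ ^ 2)
  bddBelow : BddBelow (Set.range W)
  growth : W =O[Bornology.cobounded (Space d)] (fun x => ‖x‖ ^ 2)

/-- The convolution `W * ρ`. -/
def conv {d : ℕ} (W : Space d → ℝ) (ρ : P2 d) (x : Space d) : ℝ :=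
  ∫ y, W (x - y) ∂ρ.meas

open Classical in
/-- The interaction energy `E` on `P₂(ℝ^d)`, equal to `∞` outside `P(M)`. -/
def energy {d : ℕ} (W : Space d → ℝ) (M : Set (Space d)) (ρ : P2 d) : EReal :=
  if ρ ∈ supportedIn M then (((1 / 2 : ℝ) * ∫ x in M, conv W ρ x ∂ρ.meas : ℝ) : EReal) else ⊤

/-- The `ε`-interaction energy `E_ε` on `P₂(ℝ^d)`. For admissible `W` all the integrands are
integrable, so that it is finite on `P₂(ℝ^d)`. -/
def energyEps {d : ℕ} (W : Space d → ℝ) (M : Set (Space d)) (ε : ℝ) (ρ : P2 d) : EReal :=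
  (((1 / 2 : ℝ) * ∫ x, conv W ρ x ∂ρ.meas
    + 1 / ε * ∫ x, Metric.infDist x M ^ 2 ∂ρ.meas : ℝ) : EReal)

/-- `ρ` is a minimizer of the functional `F` on `P₂(ℝ^d)`. -/
def IsMinimizer {d : ℕ} (F : P2 d → EReal) (ρ : P2 d) : Prop := ∀ μ, F ρ ≤ F μ

end AttractingManifold

end

noncomputable section

namespace AttractingManifold

/-- Weak lower semicontinuity of the integral of a continuous function bounded from below. -/
lemma integrable_and_integral_le_of_tendsto {Ω : Type*} [TopologicalSpace Ω] [MeasurableSpace Ω]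
    [OpensMeasurableSpace Ω] [HasOuterApproxClosed Ω] {μ : ProbabilityMeasure Ω}
    {μs : ℕ → ProbabilityMeasure Ω} (hμ : Tendsto μs atTop (𝓝 μ)) {f : Ω → ℝ} (hf : Continuous f)
    {c K : ℝ} (hc : ∀ x, c ≤ f x) (hint : ∀ n, Integrable f (μs n : Measure Ω))
    (hK : ∀ᶠ n in atTop, ∫ x, f x ∂(μs n : Measure Ω) ≤ K) :
    Integrable f (μ : Measure Ω) ∧ ∫ x, f x ∂(μ : Measure Ω) ≤ K := by
  have hnn : ∀ x, 0 ≤ f x - c := fun x => sub_nonneg.2 (hc x)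
  have hcont : Continuous fun x => f x - c := hf.sub continuous_const
  have hlsc := lintegral_le_liminf_lintegral_of_forall_isOpen_measure_le_liminf_measure
    (μ := (μ : Measure Ω)) (μs := fun n => (μs n : Measure Ω)) hcont hnn
    fun G hG => ProbabilityMeasure.le_liminf_measure_open_of_tendsto hμ hG
  have hbound : ∫⁻ x, ENNReal.ofReal (f x - c) ∂(μ : Measure Ω) ≤ ENNReal.ofReal (K - c) := by
    refine hlsc.trans (liminf_le_of_frequently_le' (Eventually.frequently ?_))
    filter_upwards [hK] with n hn
    rw [← ofReal_integral_eq_lintegral_ofReal (f := fun x => f x - c)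
      ((hint n).sub (integrable_const c)) (Eventually.of_forall hnn), integral_sub (hint n) (integrable_const c)]
    exact ENNReal.ofReal_le_ofReal (by simpa using hn)
  have hI : Integrable (fun x => f x - c) (μ : Measure Ω) := by
    refine ⟨hcont.aestronglyMeasurable, ?_⟩
    rw [hasFiniteIntegral_iff_ofReal (Eventually.of_forall hnn)]
    exact hbound.trans_lt ENNReal.ofReal_lt_top
  have hIf : Integrable f (μ : Measure Ω) := by
    convert! hI.add (integrable_const c) using 1
    ext x
    simp
  refine ⟨hIf, ?_⟩
  obtain ⟨n, hn⟩ := hK.exists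
  have hcK : 0 ≤ K - c := by
    have : c ≤ ∫ x, f x ∂(μs n : Measure Ω) := by
      simpa using integral_mono (integrable_const c) (hint n) hc
    linarith
  rw [← ofReal_integral_eq_lintegral_ofReal hI (Eventually.of_forall hnn),
    ENNReal.ofReal_le_ofReal_iff hcK, integral_sub hIf (integrable_const c)] at hbound
  simpa using hbound

/-- Two finite families of masses with the same total have a coupling whose off-diagonal part
carries only the excess masses. -/
lemma exists_discrete_coupling {ι : Type*} [Fintype ι] (p q : ι → ℝ≥0∞)
    (hp : ∑ i, p i = 1) (hq : ∑ i, q i = 1) :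
    ∃ e : ι → ι → ℝ≥0∞, (∀ i, ∑ j, e i j = p i - q i) ∧ (∀ j, ∑ i, e i j = q j - p j) := by
  have hpt : ∀ i, p i ≠ ∞ := fun i =>
    ne_top_of_le_ne_top (hp ▸ ENNReal.one_ne_top)
      (Finset.single_le_sum (f := p) (fun _ _ => zero_le) (Finset.mem_univ i))
  have hqt : ∀ i, q i ≠ ∞ := fun i =>
    ne_top_of_le_ne_top (hq ▸ ENNReal.one_ne_top)
      (Finset.single_le_sum (f := q) (fun _ _ => zero_le) (Finset.mem_univ i))
  have hmin : ∑ i, min (p i) (q i) ≠ ∞ :=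
    (ENNReal.sum_lt_top.2 fun i _ => (min_le_left _ _).trans_lt (hpt i).lt_top).ne
  set m := ∑ i, (p i - q i) with hm
  have hm' : ∑ i, (q i - p i) = m := by
    have h1 : ∑ i, (p i - q i) + ∑ i, min (p i) (q i) = 1 := by
      rw [← hp, ← Finset.sum_add_distrib]
      exact Finset.sum_congr rfl fun i _ => tsub_add_min
    have h2 : ∑ i, (q i - p i) + ∑ i, min (p i) (q i) = 1 := by
      rw [← hq, ← Finset.sum_add_distrib]
      exact Finset.sum_congr rfl fun i _ => by rw [min_comm]; exact tsub_add_min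
    exact (ENNReal.add_left_inj hmin).1 (h2.trans h1.symm)
  have hmt : m ≠ ∞ :=
    (ENNReal.sum_lt_top.2 fun i _ => tsub_le_self.trans_lt (hpt i).lt_top).ne
  refine ⟨fun i j => (p i - q i) * (q j - p j) / m, fun i => ?_, fun j => ?_⟩
  · simp_rw [mul_div_assoc, div_eq_mul_inv]
    rw [← Finset.mul_sum, ← Finset.sum_mul, hm']
    rcases eq_or_ne m 0 with h0 | h0
    · rw [(Finset.sum_eq_zero_iff.1 (hm.symm.trans h0)) i (Finset.mem_univ i), zero_mul]
    · rw [ENNReal.mul_inv_cancel h0 hmt, mul_one]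
  · simp_rw [mul_comm (p _ - q _), mul_div_assoc, div_eq_mul_inv]
    rw [← Finset.mul_sum, ← Finset.sum_mul, ← hm]
    rcases eq_or_ne m 0 with h0 | h0
    · rw [(Finset.sum_eq_zero_iff.1 (hm'.trans h0)) j (Finset.mem_univ j), zero_mul]
    · rw [ENNReal.mul_inv_cancel h0 hmt, mul_one]

open ProbabilityTheory in
/-- A coupling of `μ` and `ν` which matches as much mass as possible inside the fibres of a
finite-valued map `T`, with the resulting bound on the cost. -/
lemma exists_coupling_lintegral_le {X ι : Type*} [MeasurableSpace X] [Fintype ι]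
    [MeasurableSpace ι] [MeasurableSingletonClass ι] (μ ν : Measure X) [IsProbabilityMeasure μ]
    [IsProbabilityMeasure ν] {T : X → ι} (hT : Measurable T) {M : Set X} (hν : ν Mᶜ = 0)
    {f : X × X → ℝ≥0∞} (hf : Measurable f) {h : X → ℝ≥0∞} (hh : Measurable h) {δ R : ℝ≥0∞}
    (hδ : ∀ x, ∀ y ∈ M, T x = T y → f (x, y) ≤ δ) (hR : ∀ x, ∀ y ∈ M, f (x, y) ≤ h x + R) :
    ∃ π : ProbabilityMeasure (X × X), (π : Measure (X × X)).map Prod.fst = μ ∧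
      (π : Measure (X × X)).map Prod.snd = ν ∧
      ∫⁻ z, f z ∂(π : Measure (X × X)) ≤
        δ + ∫⁻ x, h x ∂μ + R * ∑ i, (μ (T ⁻¹' {i}) - ν (T ⁻¹' {i})) := by
  classical
  set p : ι → ℝ≥0∞ := fun i => μ (T ⁻¹' {i})
  set q : ι → ℝ≥0∞ := fun i => ν (T ⁻¹' {i})
  have hms : ∀ i, MeasurableSet (T ⁻¹' {i}) := fun i => hT (measurableSet_singleton i)
  have hμT : ∑ i, p i • μ[|T ⁻¹' {i}] = μ := sum_meas_smul_cond_fiber hT μ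
  have hνT : ∑ i, q i • ν[|T ⁻¹' {i}] = ν := sum_meas_smul_cond_fiber hT ν
  have hsum : ∀ (m : Measure X) [IsProbabilityMeasure m], ∑ i, m (T ⁻¹' {i}) = 1 := by
    intro m _
    have := sum_measure_preimage_singleton (μ := m) (f := T) Finset.univ fun i _ => hms i
    simpa using this
  obtain ⟨e, he1, he2⟩ := exists_discrete_coupling p q (hsum μ) (hsum ν)
  set c : ι → ι → ℝ≥0∞ := fun i j => (if i = j then min (p i) (q i) else 0) + e i j with hc
  have hc1 : ∀ i, ∑ j, c i j = p i := fun i => by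
    simp only [hc, Finset.sum_add_distrib, he1, Finset.sum_ite_eq, Finset.mem_univ, if_true]
    rw [add_comm]; exact tsub_add_min
  have hc2 : ∀ j, ∑ i, c i j = q j := fun j => by
    simp only [hc, Finset.sum_add_distrib, he2, Finset.sum_ite_eq', Finset.mem_univ, if_true]
    rw [add_comm, min_comm]; exact tsub_add_min
  have hcp : ∀ i j, c i j * (μ[|T ⁻¹' {i}]) Set.univ = c i j := by
    intro i j
    rcases eq_or_ne (p i) 0 with h0 | h0
    · have : c i j = 0 :=
        (Finset.sum_eq_zero_iff.1 ((hc1 i).trans h0)) j (Finset.mem_univ j)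
      simp [this]
    · have := cond_isProbabilityMeasure (μ := μ) h0
      simp
  have hcq : ∀ i j, c i j * (ν[|T ⁻¹' {j}]) Set.univ = c i j := by
    intro i j
    rcases eq_or_ne (q j) 0 with h0 | h0
    · have : c i j = 0 :=
        (Finset.sum_eq_zero_iff.1 ((hc2 j).trans h0)) i (Finset.mem_univ i)
      simp [this]
    · have := cond_isProbabilityMeasure (μ := ν) h0
      simp
  set π : Measure (X × X) := ∑ i, ∑ j, c i j • (μ[|T ⁻¹' {i}]).prod (ν[|T ⁻¹' {j}]) with hπ
  have hfst : π.map Prod.fst = μ := by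
    ext s hs
    rw [Measure.map_apply measurable_fst hs, ← Set.prod_univ]
    conv_rhs => rw [← hμT]
    simp only [hπ, Measure.finsetSum_apply, Measure.smul_apply, Measure.prod_prod, smul_eq_mul]
    refine Finset.sum_congr rfl fun i _ => ?_
    rw [← hc1 i, Finset.sum_mul]
    refine Finset.sum_congr rfl fun j _ => ?_
    conv_rhs => rw [← hcq i j]
    ring
  have hsnd : π.map Prod.snd = ν := by
    ext s hs
    rw [Measure.map_apply measurable_snd hs, ← Set.univ_prod]
    conv_rhs => rw [← hνT]
    simp only [hπ, Measure.finsetSum_apply, Measure.smul_apply, Measure.prod_prod, smul_eq_mul]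
    rw [Finset.sum_comm]
    refine Finset.sum_congr rfl fun j _ => ?_
    rw [← hc2 j, Finset.sum_mul]
    refine Finset.sum_congr rfl fun i _ => ?_
    conv_rhs => rw [← hcp i j]
    ring
  have hprob : IsProbabilityMeasure π := by
    refine ⟨?_⟩
    rw [← Set.preimage_univ (f := Prod.fst), ← Measure.map_apply measurable_fst MeasurableSet.univ,
      hfst, measure_univ]
  refine ⟨⟨π, hprob⟩, hfst, hsnd, ?_⟩
  have hM : ∀ᵐ y ∂ν, y ∈ M := hν
  have hMi : ∀ j, ∀ᵐ y ∂ν[|T ⁻¹' {j}], y ∈ M := fun j => cond_absolutelyContinuous.ae_le hM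
  have hle1 : ∀ (m : Measure X) (i : ι), m[|T ⁻¹' {i}] Set.univ ≤ 1 := fun m i =>
    prob_le_one
  have hdiag : ∀ i, ∫⁻ z, f z ∂(μ[|T ⁻¹' {i}]).prod (ν[|T ⁻¹' {i}]) ≤ δ := by
    intro i
    rw [lintegral_prod _ hf.aemeasurable]
    calc _ ≤ ∫⁻ _, ∫⁻ _, δ ∂(ν[|T ⁻¹' {i}]) ∂(μ[|T ⁻¹' {i}]) := by
          refine lintegral_mono_ae ?_
          filter_upwards [ae_cond_mem (hms i)] with x hx
          refine lintegral_mono_ae ?_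
          filter_upwards [ae_cond_mem (hms i), hMi i] with y hy hyM
          exact hδ x y hyM (Eq.trans hx (Eq.symm hy))
      _ ≤ δ := by
          simp only [lintegral_const]
          calc _ ≤ δ * 1 * 1 := by gcongr <;> exact hle1 _ _
            _ = δ := by simp
  have hoff : ∀ i j, ∫⁻ z, f z ∂(μ[|T ⁻¹' {i}]).prod (ν[|T ⁻¹' {j}]) ≤
      ∫⁻ x, h x ∂(μ[|T ⁻¹' {i}]) + R := by
    intro i j
    rw [lintegral_prod _ hf.aemeasurable]
    calc _ ≤ ∫⁻ x, (h x + R) ∂(μ[|T ⁻¹' {i}]) := by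
          refine lintegral_mono fun x => ?_
          calc _ ≤ ∫⁻ _, (h x + R) ∂(ν[|T ⁻¹' {j}]) := by
                refine lintegral_mono_ae ?_
                filter_upwards [hMi j] with y hyM using hR x y hyM
            _ ≤ (h x + R) * 1 := by
                rw [lintegral_const]; gcongr; exact hle1 _ _
            _ = _ := mul_one _
      _ ≤ _ := by
          rw [lintegral_add_left hh, lintegral_const]
          gcongr
          exact mul_le_of_le_one_right' (hle1 _ _)
  have hint : ∫⁻ z, f z ∂π = ∑ i, ∑ j, c i j *
      ∫⁻ z, f z ∂(μ[|T ⁻¹' {i}]).prod (ν[|T ⁻¹' {j}]) := by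
    simp only [hπ, lintegral_finsetSum_measure, lintegral_smul_measure, smul_eq_mul]
  change ∫⁻ z, f z ∂π ≤ _
  have hhT : ∑ i, p i * ∫⁻ x, h x ∂(μ[|T ⁻¹' {i}]) = ∫⁻ x, h x ∂μ := by
    conv_rhs => rw [← hμT]
    simp only [lintegral_finsetSum_measure, lintegral_smul_measure, smul_eq_mul]
  calc ∫⁻ z, f z ∂π
      = ∑ i, min (p i) (q i) * ∫⁻ z, f z ∂(μ[|T ⁻¹' {i}]).prod (ν[|T ⁻¹' {i}]) +
        ∑ i, ∑ j, e i j * ∫⁻ z, f z ∂(μ[|T ⁻¹' {i}]).prod (ν[|T ⁻¹' {j}]) := by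
        rw [hint]
        simp only [hc, add_mul, Finset.sum_add_distrib, ite_mul, zero_mul, Finset.sum_ite_eq,
          Finset.mem_univ, if_true]
    _ ≤ ∑ i, p i * δ + ∑ i, ∑ j, e i j * (∫⁻ x, h x ∂(μ[|T ⁻¹' {i}]) + R) := by
        gcongr with i _ i _ j _
        · exact min_le_left _ _
        · exact hdiag i
        · exact hoff i j
    _ = δ + ∑ i, (p i - q i) * (∫⁻ x, h x ∂(μ[|T ⁻¹' {i}]) + R) := by
        rw [← Finset.sum_mul, hsum μ, one_mul]
        simp_rw [← Finset.sum_mul, he1]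
    _ ≤ δ + (∑ i, p i * ∫⁻ x, h x ∂(μ[|T ⁻¹' {i}]) + ∑ i, R * (p i - q i)) := by
        simp_rw [mul_add, mul_comm _ R]
        rw [Finset.sum_add_distrib]
        gcongr with i _
        exact tsub_le_self
    _ = _ := by rw [hhT, ← Finset.mul_sum, add_assoc]

/-- A finite measurable partition into continuity sets of `ν` which separates any point from the
points of the compact set `M` that are not close to it. -/
lemma exists_partition_null_frontier {X : Type*} [PseudoMetricSpace X] [MeasurableSpace X]
    [OpensMeasurableSpace X] (ν : Measure X) [IsFiniteMeasure ν] {M : Set X} (hM : IsCompact M)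
    {δ : ℝ} (hδ : 0 < δ) :
    ∃ (t : Finset X) (T : X → (t → Prop)), Measurable T ∧
      (∀ i, ν (frontier (T ⁻¹' {i})) = 0) ∧ ∀ x, ∀ y ∈ M, T x = T y → dist x y ≤ 2 * δ := by
  have hr : ∀ x : X, ∃ r ∈ Set.Ioo 0 δ, ν (frontier (Metric.ball x r)) = 0 := fun x => by
    obtain ⟨r, hr, h⟩ := exists_null_frontier_thickening ν {x} hδ
    exact ⟨r, hr, by rwa [Metric.thickening_singleton] at h⟩
  choose r hr0 hrν using hr
  obtain ⟨t, -, ht⟩ := hM.elim_nhds_subcover (fun x => Metric.ball x (r x))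
    fun x _ => Metric.ball_mem_nhds x (hr0 x).1
  refine ⟨t, fun x a => x ∈ Metric.ball (a : X) (r a), ?_, fun i => ?_, fun x y hy hxy => ?_⟩
  · exact measurable_pi_iff.2 fun a => Metric.isOpen_ball.measurableSet.mem
  · have hnull : ν (⋃ a : t, frontier (Metric.ball (a : X) (r a))) = 0 :=
      measure_iUnion_null fun a => hrν a
    refine measure_mono_null (fun x hx => ?_) hnull
    by_contra hxn
    simp only [Set.mem_iUnion, not_exists] at hxn
    have hloc : ∀ a : t, ∀ᶠ z in 𝓝 x,
        (z ∈ Metric.ball (a : X) (r a)) = (x ∈ Metric.ball (a : X) (r a)) := by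
      intro a
      by_cases hxa : x ∈ Metric.ball (a : X) (r a)
      · filter_upwards [Metric.isOpen_ball.mem_nhds hxa] with z hz
        exact propext ⟨fun _ => hxa, fun _ => hz⟩
      · have hxc : x ∉ closure (Metric.ball (a : X) (r a)) := fun h =>
          hxn a ⟨h, fun h' => hxa (interior_subset h')⟩
        filter_upwards [isClosed_closure.isOpen_compl.mem_nhds hxc] with z hz
        exact propext ⟨fun h => absurd (subset_closure h) hz, fun h => absurd h hxa⟩
    have hall := eventually_all.2 hloc
    rw [frontier_eq_closure_inter_closure] at hx
    obtain ⟨z, hz, hzi⟩ := (mem_closure_iff_frequently.1 hx.1).and_eventually hall |>.exists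
    obtain ⟨w, hw, hwi⟩ := (mem_closure_iff_frequently.1 hx.2).and_eventually hall |>.exists
    refine hw (Eq.trans ?_ hz)
    funext a
    exact (hwi a).trans (hzi a).symm
  · obtain ⟨a, ha, hya⟩ := Set.mem_iUnion₂.1 (ht hy)
    have hxa : x ∈ Metric.ball a (r a) := by
      have := congrFun hxy ⟨a, ha⟩
      exact this.mpr hya
    have h1 := Metric.mem_ball.1 hxa
    have h2 := Metric.mem_ball.1 hya
    have := dist_triangle_right x y a
    linarith [(hr0 a).2]

variable {d : ℕ}

lemma ennreal_add_sq_le (a b : ℝ≥0∞) : (a + b) ^ 2 ≤ 2 * a ^ 2 + 2 * b ^ 2 := by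
  have h := ENNReal.rpow_add_le_mul_rpow_add_rpow a b (p := 2) one_le_two
  rw [← mul_add]
  norm_num at h
  exact_mod_cast h

/-- Weak convergence to a measure supported in the compact set `M`, together with convergence to
zero of the mean squared distance to `M`, implies convergence in the Wasserstein distance. -/
lemma tendsto_wasserstein {M : Set (Space d)} (hM : IsCompact M) {μs : ℕ → P2 d} {μ : P2 d}
    (hweak : Tendsto (fun n => (μs n).1) atTop (𝓝 μ.1)) (hμ : μ ∈ supportedIn M)
    (hdist : Tendsto (fun n => ∫⁻ x, Metric.infEDist x M ^ 2 ∂(μs n).meas) atTop (𝓝 0)) :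
    Tendsto (fun n => wasserstein (μs n) μ) atTop (𝓝 0) := by
  rw [ENNReal.tendsto_nhds_zero]
  intro η hη
  obtain ⟨δ, hδ0, hδη⟩ : ∃ δ : ℝ, 0 < δ ∧ 4 * ENNReal.ofReal δ ≤ η := by
    rcases eq_or_ne η ∞ with rfl | hηt
    · exact ⟨1, one_pos, le_top⟩
    · refine ⟨η.toReal / 4, div_pos (ENNReal.toReal_pos hη.ne' hηt) (by norm_num), ?_⟩
      rw [show (4 : ℝ≥0∞) = ENNReal.ofReal 4 by norm_num, ← ENNReal.ofReal_mul (by norm_num)]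
      rw [mul_div_cancel₀ _ (by norm_num : (4 : ℝ) ≠ 0), ENNReal.ofReal_toReal hηt]
  obtain ⟨t, T, hTm, hTν, hTd⟩ := exists_partition_null_frontier μ.meas hM hδ0
  have hDt : 2 * Metric.ediam M ^ 2 ≠ ∞ :=
    ENNReal.mul_ne_top (by simp) (ENNReal.pow_ne_top hM.isBounded.ediam_ne_top)
  set s : ℕ → ℝ≥0∞ := fun n => ∑ i, ((μs n).meas (T ⁻¹' {i}) - μ.meas (T ⁻¹' {i}))
  have hs0 : Tendsto s atTop (𝓝 0) := by
    rw [show (0 : ℝ≥0∞) = ∑ i, (μ.meas (T ⁻¹' {i}) - μ.meas (T ⁻¹' {i})) by simp]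
    refine tendsto_finsetSum _ fun i _ => ?_
    exact ENNReal.Tendsto.sub
      (ProbabilityMeasure.tendsto_measure_of_null_frontier_of_tendsto' hweak (hTν i))
      tendsto_const_nhds (Or.inl (measure_ne_top _ _))
  have hrem : Tendsto (fun n => ∫⁻ x, 2 * Metric.infEDist x M ^ 2 ∂(μs n).meas
      + 2 * Metric.ediam M ^ 2 * s n) atTop (𝓝 0) := by
    have hmeas : Measurable fun x : Space d => Metric.infEDist x M ^ 2 := by fun_prop
    simp_rw [lintegral_const_mul _ hmeas]
    simpa using (ENNReal.Tendsto.const_mul hdist (Or.inr (by simp : (2 : ℝ≥0∞) ≠ ∞))).add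
      (ENNReal.Tendsto.const_mul hs0 (Or.inr hDt))
  have hδpos : 0 < (2 * ENNReal.ofReal δ) ^ 2 := by positivity
  filter_upwards [(ENNReal.tendsto_nhds_zero.1 hrem) _ hδpos] with n hn
  obtain ⟨π, hπ1, hπ2, hπ⟩ := exists_coupling_lintegral_le (μs n).meas μ.meas hTm hμ
    (f := fun z => edist z.1 z.2 ^ 2) (by fun_prop)
    (h := fun x => 2 * Metric.infEDist x M ^ 2) (by fun_prop)
    (δ := (2 * ENNReal.ofReal δ) ^ 2) (R := 2 * Metric.ediam M ^ 2)
    (fun x y hy hxy => by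
      gcongr
      rw [edist_dist]
      refine (ENNReal.ofReal_le_ofReal (hTd x y hy hxy)).trans_eq ?_
      rw [ENNReal.ofReal_mul zero_le_two, ENNReal.ofReal_ofNat])
    (fun x y hy => by
      refine le_trans ?_ (ennreal_add_sq_le _ _)
      gcongr
      obtain ⟨m, hm, hxm⟩ := hM.exists_infEDist_eq_edist ⟨y, hy⟩ x
      rw [hxm]
      exact (edist_triangle x m y).trans (by gcongr; exact Metric.edist_le_ediam_of_mem hm hy))
  calc wasserstein (μs n) μ
      ≤ (∫⁻ z, edist z.1 z.2 ^ 2 ∂(π : Measure (Space d × Space d))) ^ (1 / 2 : ℝ) :=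
        iInf₂_le π ⟨hπ1, hπ2⟩
    _ ≤ ((4 * ENNReal.ofReal δ) ^ 2) ^ (1 / 2 : ℝ) := by
        gcongr
        calc _ ≤ (2 * ENNReal.ofReal δ) ^ 2 + (2 * ENNReal.ofReal δ) ^ 2 := by
              refine hπ.trans ?_
              rw [add_assoc]
              gcongr
          _ ≤ (2 * ENNReal.ofReal δ + 2 * ENNReal.ofReal δ) ^ 2 := by
              rw [add_sq]
              gcongr
              exact le_self_add
          _ = _ := by ring
    _ = 4 * ENNReal.ofReal δ := by
        rw [← ENNReal.rpow_natCast, ← ENNReal.rpow_mul]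
        norm_num
    _ ≤ η := hδη

/-- Sequences with bounded second moments are weakly precompact, with limits in `P₂`. -/
lemma exists_subseq_tendsto_of_moment_le {μs : ℕ → P2 d} {C : ℝ≥0∞} (hC : C ≠ ∞)
    (hμ : ∀ n, ∫⁻ x, ‖x‖ₑ ^ 2 ∂(μs n).meas ≤ C) :
    ∃ φ : ℕ → ℕ, StrictMono φ ∧ ∃ μ : P2 d, Tendsto (fun k => (μs (φ k)).1) atTop (𝓝 μ.1) := by
  have htight : IsTightMeasureSet
      {((m : ProbabilityMeasure (Space d)) : Measure (Space d)) |
        m ∈ Set.range fun n => (μs n).1} := by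
    rw [isTightMeasureSet_iff_exists_isCompact_measure_compl_le]
    intro ε hε
    obtain ⟨r, hr0, hr⟩ : ∃ r : ℝ, 0 < r ∧ C / ENNReal.ofReal r ^ 2 ≤ ε := by
      have : Tendsto (fun r : ℝ => C / ENNReal.ofReal r ^ 2) atTop (𝓝 0) := by
        have h2 : Tendsto (fun r : ℝ => ENNReal.ofReal r ^ 2) atTop (𝓝 ∞) := by
          simpa using ENNReal.Tendsto.pow (n := 2) ENNReal.tendsto_ofReal_atTop
        simpa using ENNReal.Tendsto.const_div h2 (Or.inr hC)
      obtain ⟨r, h1, h2⟩ := ((eventually_gt_atTop 0).and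
        (ENNReal.tendsto_nhds_zero.1 this ε hε)).exists
      exact ⟨r, h1, h2⟩
    refine ⟨Metric.closedBall 0 r, isCompact_closedBall _ _, ?_⟩
    rintro _ ⟨_, ⟨n, rfl⟩, rfl⟩
    refine le_trans ?_ hr
    have hr2 : ENNReal.ofReal r ^ 2 ≠ 0 := by positivity
    calc (μs n).meas (Metric.closedBall 0 r)ᶜ
        ≤ (μs n).meas {x | ENNReal.ofReal r ^ 2 ≤ ‖x‖ₑ ^ 2} := by
          refine measure_mono fun x hx => ?_
          have : r ≤ ‖x‖ := by
            simpa using (not_le.1 (mt mem_closedBall_zero_iff.2 hx)).le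
          change ENNReal.ofReal r ^ 2 ≤ ‖x‖ₑ ^ 2
          rw [← ofReal_norm]
          gcongr
      _ ≤ (∫⁻ x, ‖x‖ₑ ^ 2 ∂(μs n).meas) / ENNReal.ofReal r ^ 2 :=
          meas_ge_le_lintegral_div (by fun_prop) hr2 (ENNReal.pow_ne_top ENNReal.ofReal_ne_top)
      _ ≤ _ := by gcongr; exact hμ n
  have hcomp := isCompact_closure_of_isTightMeasureSet htight
  obtain ⟨m, -, φ, hφ, hlim⟩ := hcomp.tendsto_subseq (x := fun n => (μs n).1)
    fun n => subset_closure ⟨n, rfl⟩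
  refine ⟨φ, hφ, ⟨m, ?_⟩, hlim⟩
  have hlsc := lintegral_le_liminf_lintegral_of_forall_isOpen_measure_le_liminf_measure
    (μ := (m : Measure (Space d))) (μs := fun n => (μs (φ n)).meas)
    (f := fun x : Space d => ‖x‖ ^ 2) (by fun_prop) (fun x => sq_nonneg _)
    fun G hG => ProbabilityMeasure.le_liminf_measure_open_of_tendsto hlim hG
  simp only [ENNReal.ofReal_pow (norm_nonneg _), ofReal_norm] at hlsc
  exact (hlsc.trans (liminf_le_of_frequently_le'
    (Eventually.of_forall fun n => hμ (φ n)).frequently)).trans_lt hC.lt_top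

lemma P2.integrable_norm_sq (ρ : P2 d) : Integrable (fun x => ‖x‖ ^ 2) ρ.meas := by
  refine ⟨by fun_prop, ?_⟩
  rw [hasFiniteIntegral_iff_ofReal (Eventually.of_forall fun x => sq_nonneg _)]
  simpa only [ENNReal.ofReal_pow (norm_nonneg _), ofReal_norm] using ρ.2

lemma integrable_infDist_sq (ρ : P2 d) {M : Set (Space d)} (hM : M.Nonempty) :
    Integrable (fun x => Metric.infDist x M ^ 2) ρ.meas := by
  obtain ⟨m, hm⟩ := hM
  refine ((ρ.integrable_norm_sq.const_mul 2).add (integrable_const (2 * ‖m‖ ^ 2))).mono'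
    (by fun_prop) (Eventually.of_forall fun x => ?_)
  have h1 : Metric.infDist x M ≤ ‖x‖ + ‖m‖ :=
    (Metric.infDist_le_dist_of_mem hm).trans (by rw [dist_eq_norm]; exact norm_sub_le _ _)
  rw [Real.norm_of_nonneg (sq_nonneg _)]
  have h0 : 0 ≤ Metric.infDist x M := Metric.infDist_nonneg
  simp only [Pi.add_apply]
  nlinarith [sq_nonneg (‖x‖ - ‖m‖), norm_nonneg x, norm_nonneg m]

lemma lintegral_infEDist_sq (ρ : P2 d) {M : Set (Space d)} (hM : M.Nonempty) :
    ∫⁻ x, Metric.infEDist x M ^ 2 ∂ρ.meas =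
      ENNReal.ofReal (∫ x, Metric.infDist x M ^ 2 ∂ρ.meas) := by
  rw [ofReal_integral_eq_lintegral_ofReal (integrable_infDist_sq ρ hM)
    (Eventually.of_forall fun x => sq_nonneg _)]
  refine lintegral_congr fun x => ?_
  rw [ENNReal.ofReal_pow Metric.infDist_nonneg, Metric.infDist,
    ENNReal.ofReal_toReal (Metric.infEDist_ne_top hM)]

/-- The second moment is controlled by the mean squared distance to a compact set. -/
lemma exists_moment_le {M : Set (Space d)} (hM : IsCompact M) (hne : M.Nonempty) (K : ℝ) :
    ∃ C : ℝ≥0∞, C ≠ ∞ ∧ ∀ ρ : P2 d, ∫ x, Metric.infDist x M ^ 2 ∂ρ.meas ≤ K →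
      ∫⁻ x, ‖x‖ₑ ^ 2 ∂ρ.meas ≤ C := by
  obtain ⟨R, hR⟩ := hM.isBounded.exists_norm_le
  refine ⟨2 * ENNReal.ofReal K + 2 * ENNReal.ofReal R ^ 2, by finiteness, fun ρ hρ => ?_⟩
  calc ∫⁻ x, ‖x‖ₑ ^ 2 ∂ρ.meas
      ≤ ∫⁻ x, (2 * Metric.infEDist x M ^ 2 + 2 * ENNReal.ofReal R ^ 2) ∂ρ.meas := by
        refine lintegral_mono fun x => le_trans ?_ (ennreal_add_sq_le _ _)
        gcongr
        obtain ⟨m, hm, hxm⟩ := hM.exists_infEDist_eq_edist hne x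
        rw [hxm, edist_eq_enorm_sub]
        calc ‖x‖ₑ = ‖(x - m) + m‖ₑ := by rw [sub_add_cancel]
          _ ≤ ‖x - m‖ₑ + ‖m‖ₑ := enorm_add_le _ _
          _ ≤ _ := by
            gcongr
            rw [← ofReal_norm]
            exact ENNReal.ofReal_le_ofReal (hR m hm)
    _ = 2 * ENNReal.ofReal (∫ x, Metric.infDist x M ^ 2 ∂ρ.meas) + 2 * ENNReal.ofReal R ^ 2 := by
        rw [lintegral_add_right _ measurable_const, lintegral_const, measure_univ, mul_one,
          lintegral_const_mul _ (by fun_prop), lintegral_infEDist_sq ρ hne]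
    _ ≤ _ := by gcongr

lemma IsAdmissiblePotential.continuous {W : Space d → ℝ} (hW : IsAdmissiblePotential W) :
    Continuous W := hW.contDiff.continuous

lemma IsAdmissiblePotential.exists_bound {W : Space d → ℝ} (hW : IsAdmissiblePotential W) :
    ∃ C : ℝ, 0 ≤ C ∧ ∀ x, |W x| ≤ C * (1 + ‖x‖ ^ 2) := by
  obtain ⟨A, hA0, hA⟩ := hW.growth.exists_nonneg
  obtain ⟨r, -, hr⟩ := (Metric.hasBasis_cobounded_compl_closedBall (0 : Space d)).eventually_iff.1
    hA.bound
  obtain ⟨B, hB⟩ := (isCompact_closedBall (0 : Space d) r).exists_bound_of_continuousOn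
    hW.continuous.continuousOn
  refine ⟨max A B, le_max_of_le_left hA0, fun x => ?_⟩
  have hx := sq_nonneg ‖x‖
  have hm : 0 ≤ max A B := le_max_of_le_left hA0
  by_cases h : x ∈ Metric.closedBall (0 : Space d) r
  · have h1 : |W x| ≤ max A B := (hB x h).trans (le_max_right _ _)
    nlinarith
  · have h1 := hr h
    rw [Real.norm_eq_abs, Real.norm_of_nonneg hx] at h1
    nlinarith [mul_le_mul_of_nonneg_right (le_max_left A B) hx]

lemma IsAdmissiblePotential.integrable_prod {W : Space d → ℝ} (hW : IsAdmissiblePotential W)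
    (ρ : P2 d) : Integrable (fun z : Space d × Space d => W (z.1 - z.2)) (ρ.meas.prod ρ.meas) := by
  obtain ⟨C, hC0, hC⟩ := hW.exists_bound
  have h1 := ρ.integrable_norm_sq.comp_fst ρ.meas
  have h2 := ρ.integrable_norm_sq.comp_snd ρ.meas
  refine (((integrable_const 1).add ((h1.add h2).const_mul 2)).const_mul C).mono'
    (hW.continuous.comp (by fun_prop)).aestronglyMeasurable (Eventually.of_forall fun z => ?_)
  refine (hC _).trans (mul_le_mul_of_nonneg_left ?_ hC0)
  have h := norm_sub_le z.1 z.2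
  simp only [Pi.add_apply]
  nlinarith [sq_nonneg (‖z.1‖ - ‖z.2‖), norm_nonneg z.1, norm_nonneg z.2, norm_nonneg (z.1 - z.2)]

/-- The real-valued `ε`-interaction energy. -/
def realEnergyEps (W : Space d → ℝ) (M : Set (Space d)) (ε : ℝ) (ρ : P2 d) : ℝ :=
  1 / 2 * ∫ x, conv W ρ x ∂ρ.meas + 1 / ε * ∫ x, Metric.infDist x M ^ 2 ∂ρ.meas

/-- The density of the `ε`-interaction energy with respect to `ρ ⊗ ρ`. -/
def energyDensity (W : Space d → ℝ) (M : Set (Space d)) (ε : ℝ) (z : Space d × Space d) : ℝ :=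
  1 / 2 * W (z.1 - z.2) + 1 / ε * Metric.infDist z.1 M ^ 2

section

variable {W : Space d → ℝ} {M : Set (Space d)}

lemma isMinimizer_energyEps_iff {ε : ℝ} {ρ : P2 d} :
    IsMinimizer (energyEps W M ε) ρ ↔ ∀ μ, realEnergyEps W M ε ρ ≤ realEnergyEps W M ε μ :=
  forall_congr' fun _ => EReal.coe_le_coe_iff

lemma integral_conv (hW : IsAdmissiblePotential W) (ρ : P2 d) :
    ∫ x, conv W ρ x ∂ρ.meas = ∫ z, W (z.1 - z.2) ∂ρ.meas.prod ρ.meas :=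
  (integral_prod _ (hW.integrable_prod ρ)).symm

lemma continuous_energyDensity (hW : IsAdmissiblePotential W) (ε : ℝ) :
    Continuous (energyDensity W M ε) := by
  have := hW.continuous
  unfold energyDensity
  fun_prop

lemma integrable_energyDensity (hW : IsAdmissiblePotential W) (hne : M.Nonempty) (ε : ℝ)
    (ρ : P2 d) : Integrable (energyDensity W M ε) (ρ.meas.prod ρ.meas) :=
  ((hW.integrable_prod ρ).const_mul _).add
    (((integrable_infDist_sq ρ hne).comp_fst ρ.meas).const_mul _)

lemma integral_energyDensity (hW : IsAdmissiblePotential W) (hne : M.Nonempty) (ε : ℝ)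
    (ρ : P2 d) : ∫ z, energyDensity W M ε z ∂ρ.meas.prod ρ.meas = realEnergyEps W M ε ρ := by
  unfold energyDensity realEnergyEps
  rw [integral_add ((hW.integrable_prod ρ).const_mul _)
    (((integrable_infDist_sq ρ hne).comp_fst ρ.meas).const_mul _), integral_const_mul,
    integral_const_mul, integral_conv hW, integral_fun_fst (fun x => Metric.infDist x M ^ 2)]
  simp

lemma le_integral_conv (hW : IsAdmissiblePotential W) {c : ℝ} (hc : ∀ x, c ≤ W x) (ρ : P2 d) :
    c ≤ ∫ x, conv W ρ x ∂ρ.meas := by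
  rw [integral_conv hW]
  simpa using integral_mono (integrable_const c) (hW.integrable_prod ρ) fun z => hc _

/-- Weak lower semicontinuity of the `ε`-interaction energy. -/
lemma realEnergyEps_le_of_tendsto (hW : IsAdmissiblePotential W) (hne : M.Nonempty) {ε : ℝ}
    (hε : 0 < ε) {μs : ℕ → P2 d} {μ : P2 d}
    (hweak : Tendsto (fun n => (μs n).1) atTop (𝓝 μ.1)) {K : ℝ}
    (hK : ∀ᶠ n in atTop, realEnergyEps W M ε (μs n) ≤ K) : realEnergyEps W M ε μ ≤ K := by
  obtain ⟨c, hc⟩ := hW.bddBelow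
  have hprod : Tendsto (fun n => (μs n).1.prod (μs n).1) atTop (𝓝 (μ.1.prod μ.1)) :=
    (ProbabilityMeasure.continuous_prod.tendsto (μ.1, μ.1)).comp (hweak.prodMk_nhds hweak)
  rw [← integral_energyDensity hW hne]
  refine (integrable_and_integral_le_of_tendsto hprod (continuous_energyDensity hW ε)
    (c := 1 / 2 * c) (fun z => ?_) (fun n => integrable_energyDensity hW hne ε (μs n)) ?_).2
  · have h1 : c ≤ W (z.1 - z.2) := hc ⟨_, rfl⟩
    have h2 : 0 ≤ 1 / ε * Metric.infDist z.1 M ^ 2 := by positivity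
    unfold energyDensity
    linarith
  · simpa only [ProbabilityMeasure.toMeasure_prod, integral_energyDensity hW hne] using hK

lemma integral_infDist_sq_le (hW : IsAdmissiblePotential W) {c : ℝ} (hc : ∀ x, c ≤ W x) {ε : ℝ}
    (hε : 0 < ε) {ρ : P2 d} {K : ℝ} (hK : realEnergyEps W M ε ρ ≤ K) :
    ∫ x, Metric.infDist x M ^ 2 ∂ρ.meas ≤ ε * (K - 1 / 2 * c) := by
  have h := le_integral_conv hW hc ρ
  have h2 : 1 / ε * ∫ x, Metric.infDist x M ^ 2 ∂ρ.meas ≤ K - 1 / 2 * c := by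
    unfold realEnergyEps at hK
    linarith
  rwa [one_div, inv_mul_le_iff₀ hε] at h2

/-- The Dirac mass at `m` as an element of `P₂`. -/
def diracP2 (m : Space d) : P2 d :=
  ⟨⟨Measure.dirac m, inferInstance⟩, by
    change ∫⁻ x, ‖x‖ₑ ^ 2 ∂(Measure.dirac m) < ∞
    rw [lintegral_dirac]
    finiteness⟩

lemma diracP2_mem_supportedIn (hM : IsCompact M) {m : Space d} (hm : m ∈ M) :
    diracP2 m ∈ supportedIn M := by
  change (Measure.dirac m) Mᶜ = 0
  rw [Measure.dirac_apply' _ hM.measurableSet.compl]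
  simpa using hm

lemma integral_infDist_sq_of_mem {ρ : P2 d} (hρ : ρ ∈ supportedIn M) :
    ∫ x, Metric.infDist x M ^ 2 ∂ρ.meas = 0 := by
  have hae : ∀ᵐ x ∂ρ.meas, x ∈ M := hρ
  refine integral_eq_zero_of_ae ?_
  filter_upwards [hae] with x hx
  simp [Metric.infDist_zero_of_mem hx]

lemma mem_supportedIn_of_integral_le (hM : IsCompact M) (hne : M.Nonempty) {ρ : P2 d}
    (h : ∫ x, Metric.infDist x M ^ 2 ∂ρ.meas ≤ 0) : ρ ∈ supportedIn M := by
  have h0 := (integral_eq_zero_iff_of_nonneg (fun x => sq_nonneg _)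
    (integrable_infDist_sq ρ hne)).1 (h.antisymm (integral_nonneg fun x => sq_nonneg _))
  have hae : ∀ᵐ x ∂ρ.meas, x ∈ M := by
    filter_upwards [h0] with x hx
    exact (hM.isClosed.mem_iff_infDist_zero hne).2 (by simpa using hx)
  exact hae

lemma realEnergyEps_of_mem {ρ : P2 d} (hρ : ρ ∈ supportedIn M) (ε : ℝ) :
    realEnergyEps W M ε ρ = 1 / 2 * ∫ x, conv W ρ x ∂ρ.meas := by
  rw [realEnergyEps, integral_infDist_sq_of_mem hρ, mul_zero, add_zero]

lemma energy_of_mem {ρ : P2 d} (hρ : ρ ∈ supportedIn M) :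
    energy W M ρ = ((1 / 2 * ∫ x, conv W ρ x ∂ρ.meas : ℝ) : EReal) := by
  have hae : ∀ᵐ x ∂ρ.meas, x ∈ M := hρ
  rw [energy, if_pos hρ, Measure.restrict_eq_self_of_ae_mem hae]

lemma isMinimizer_energy (ρ : P2 d) (hρ : ρ ∈ supportedIn M)
    (h : ∀ μ ∈ supportedIn M, ∫ x, conv W ρ x ∂ρ.meas ≤ ∫ x, conv W μ x ∂μ.meas) :
    IsMinimizer (energy W M) ρ := by
  intro μ
  by_cases hμ : μ ∈ supportedIn M
  · rw [energy_of_mem hρ, energy_of_mem hμ, EReal.coe_le_coe_iff]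
    linarith [h μ hμ]
  · rw [energy, energy, if_neg hμ]
    exact le_top

/-- Existence of minimizers of the `ε`-interaction energy. -/
lemma exists_isMinimizer_energyEps (hM : IsCompact M) (hne : M.Nonempty)
    (hW : IsAdmissiblePotential W) {ε : ℝ} (hε : 0 < ε) :
    ∃ ρ : P2 d, IsMinimizer (energyEps W M ε) ρ := by
  obtain ⟨c, hc'⟩ := hW.bddBelow
  have hc : ∀ x, c ≤ W x := fun x => hc' ⟨x, rfl⟩
  have hbdd : BddBelow (Set.range (realEnergyEps W M ε)) := by
    refine ⟨1 / 2 * c, ?_⟩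
    rintro _ ⟨ρ, rfl⟩
    have h1 := le_integral_conv hW hc ρ
    have h2 : 0 ≤ 1 / ε * ∫ x, Metric.infDist x M ^ 2 ∂ρ.meas :=
      mul_nonneg (by positivity) (integral_nonneg fun x => sq_nonneg _)
    unfold realEnergyEps
    linarith
  obtain ⟨u, hu, hulim, humem⟩ :=
    exists_seq_tendsto_sInf ⟨_, Set.mem_range_self (diracP2 (0 : Space d))⟩ hbdd
  choose μs hμs using humem
  obtain ⟨C, hC, hmom⟩ := exists_moment_le hM hne (ε * (u 0 - 1 / 2 * c))
  obtain ⟨φ, hφ, μ, hμ⟩ := exists_subseq_tendsto_of_moment_le hC fun n =>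
    hmom (μs n) (integral_infDist_sq_le hW hc hε ((hμs n).trans_le (hu (Nat.zero_le n))))
  refine ⟨μ, isMinimizer_energyEps_iff.2 fun ν => ?_⟩
  refine le_trans ?_ (csInf_le hbdd ⟨ν, rfl⟩)
  refine le_of_forall_pos_le_add fun η hη => realEnergyEps_le_of_tendsto hW hne hε hμ ?_
  filter_upwards [(hulim.comp hφ.tendsto_atTop).eventually_le_const
    (lt_add_of_pos_right _ hη)] with n hn
  rw [hμs]
  exact hn

/-- Minimizers of the `ε`-interaction energies accumulate at minimizers of the limit energy. -/
lemma exists_subseq_tendsto_isMinimizer (hM : IsCompact M) (hne : M.Nonempty)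
    (hW : IsAdmissiblePotential W) {e : ℕ → ℝ} (he : ∀ n, 0 < e n) (he0 : Tendsto e atTop (𝓝 0))
    {ρ : ℕ → P2 d} (hρ : ∀ n, IsMinimizer (energyEps W M (e n)) (ρ n)) :
    ∃ φ : ℕ → ℕ, StrictMono φ ∧ ∃ ρlim : P2 d, ρlim ∈ supportedIn M ∧
      Tendsto (fun k => wasserstein (ρ (φ k)) ρlim) atTop (𝓝 0) ∧
      IsMinimizer (energy W M) ρlim := by
  obtain ⟨c, hc'⟩ := hW.bddBelow
  have hc : ∀ x, c ≤ W x := fun x => hc' ⟨x, rfl⟩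
  have hle : ∀ n, ∀ μ ∈ supportedIn M,
      realEnergyEps W M (e n) (ρ n) ≤ 1 / 2 * ∫ x, conv W μ x ∂μ.meas := fun n μ hμ =>
    (isMinimizer_energyEps_iff.1 (hρ n) μ).trans_eq (realEnergyEps_of_mem hμ _)
  obtain ⟨m, hm⟩ := id hne
  set K := 1 / 2 * ∫ x, conv W (diracP2 m) x ∂(diracP2 m).meas - 1 / 2 * c
  have hd : ∀ n, ∫ x, Metric.infDist x M ^ 2 ∂(ρ n).meas ≤ e n * K := fun n =>
    integral_infDist_sq_le hW hc (he n) (hle n _ (diracP2_mem_supportedIn hM hm))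
  have hd0 : Tendsto (fun n => ∫ x, Metric.infDist x M ^ 2 ∂(ρ n).meas) atTop (𝓝 0) :=
    squeeze_zero (fun n => integral_nonneg fun x => sq_nonneg _) hd
      (by simpa using he0.mul_const K)
  obtain ⟨B, hB⟩ := hd0.bddAbove_range
  obtain ⟨C, hC, hmom⟩ := exists_moment_le hM hne B
  obtain ⟨φ, hφ, μ, hμ⟩ := exists_subseq_tendsto_of_moment_le hC fun n =>
    hmom (ρ n) (hB ⟨n, rfl⟩)
  have hdφ := hd0.comp hφ.tendsto_atTop
  have hsupp : μ ∈ supportedIn M := by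
    refine mem_supportedIn_of_integral_le hM hne (le_of_forall_pos_le_add fun η hη => ?_)
    refine (integrable_and_integral_le_of_tendsto hμ (f := fun x => Metric.infDist x M ^ 2)
      (by fun_prop) (c := 0) (fun x => sq_nonneg _)
      (fun n => integrable_infDist_sq (ρ (φ n)) hne) ?_).2
    exact hdφ.eventually_le_const (lt_add_of_pos_right _ hη)
  refine ⟨φ, hφ, μ, hsupp, tendsto_wasserstein hM hμ hsupp ?_, isMinimizer_energy μ hsupp ?_⟩
  · simp_rw [lintegral_infEDist_sq _ hne]
    simpa using ENNReal.tendsto_ofReal hdφ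
  · intro ν hν
    have hlim : realEnergyEps W M 1 μ ≤ 1 / 2 * ∫ x, conv W ν x ∂ν.meas := by
      refine realEnergyEps_le_of_tendsto hW hne one_pos hμ ?_
      filter_upwards [(he0.comp hφ.tendsto_atTop).eventually_le_const one_pos] with n hn
      refine le_trans ?_ (hle (φ n) ν hν)
      unfold realEnergyEps
      gcongr
      exacts [he _, hn]
    rw [realEnergyEps_of_mem hsupp] at hlim
    linarith

end

end AttractingManifold

end

open AttractingManifold in
theorem lemma2p2 {d : ℕ} (M : Set (Space d)) (hMc : IsCompact M) (hMne : M.Nonempty)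
    (hMr : 0 < reach M) (W : Space d → ℝ) (hW : IsAdmissiblePotential W) :
    (∀ ε : ℝ, 0 < ε → ∃ ρ : P2 d, IsMinimizer (energyEps W M ε) ρ) ∧
    (∀ ρ : ℝ → P2 d, (∀ ε : ℝ, 0 < ε → IsMinimizer (energyEps W M ε) (ρ ε)) →
      ∀ e : ℕ → ℝ, (∀ n, 0 < e n) → Tendsto e atTop (𝓝 0) →
        ∃ φ : ℕ → ℕ, StrictMono φ ∧ ∃ ρlim : P2 d, ρlim ∈ supportedIn M ∧
          Tendsto (fun k => wasserstein (ρ (e (φ k))) ρlim) atTop (𝓝 0) ∧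
          IsMinimizer (energy W M) ρlim) := by
  refine ⟨fun ε hε => exists_isMinimizer_energyEps hMc hMne hW hε, fun ρ hρ e he he0 => ?_⟩
  exact exists_subseq_tendsto_isMinimizer (ρ := fun n => ρ (e n)) hMc hMne hW he he0
    fun n => hρ (e n) (he n)
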